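/- **Setting.** Let $d,k,n$ be natural numbers with $2k\le n$. For a permutation $\sigma\in S(n)$ let $V_\sigma$ be the operator on $(\mathbb C^d)^{\otimes n}$ permuting the tensor factors, $V_\sigma|x_1\cdots x_n\rangle=|x_{\sigma^{-1}(1)}\cdots x_{\sigma^{-1}(n)}\rangle$; for $l\le n$ the group $S(l)\subseteq S(n)$ permutes the first $l$ factors. Let $V_{a,b}$ be the swap of the factors $a,b$, let $t_b$ denote partial transposition on the factor $b$ (in the standard basis), and put $$V^{(k)}=V^{t_n}_{n-2k+1,n}\,V^{t_{n-1}}_{n-2k+2,n-1}\cdots V^{t_{n-k+1}}_{n-k,n-k+1}.$$ For Young diagrams $\mu\vdash l$ and $\alpha\vdash l'$, $l'\le l$, a path $r_{\mu/\alpha}$ is a chain of Young diagrams from $\mu$ to $\alpha$ in which each step removes one box. A basis index $i_\mu$ is a path from $\mu$ to the empty diagram; for each $l'\le l$ it is written uniquely as $i_\mu=(r_{\mu/\alpha},l_\alpha)$ with $\alpha\vdash l'$ and $l_\alpha$ a basis index of $\alpha$. A Kronecker delta of two paths is $1$ if they are the same path (in particular have the same end diagrams) and $0$ otherwise. Let $(\phi^\mu)$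 be any family of unitary irreducible matrix representations, one for each Young diagram $\mu\vdash l$ and each $l\ge 0$, $\phi^\mu$ being a representation of $S(l)$ with rows and columns indexed by the basis indices of $\mu$, such that distinct diagrams with the same number of boxes label inequivalent irreps and such that all $\phi^\mu$ are in partially reduced (PRIR) form: for $l'\le l$, $\mu\vdash l$ and $\varkappa\in S(l')\subseteq S(l)$, $$\phi^\mu_{(r_{\mu/\alpha},i_\alpha)\,(\tilde r_{\mu/\beta},j_\beta)}(\varkappa)=\delta^{r_{\mu/\alpha}\tilde r_{\mu/\beta}}\,\phi^\alpha_{i_\alpha j_\alpha}(\varkappa)\qquad(\alpha,\beta\vdash l').$$ Let $d_\mu$ be the dimension of $\phi^\mu$, and for $\mu\vdash l$ let $m_\mu$ be the multiplicity of $\phi^\mu$ in the representation $\sigma\mapsto V_\sigma$ of $S(l)$ on $(\mathbb C^d)^{\otimes l}$ (the Schur–Weyl multiplicity). For $\mu\vdash l\le n$ put $$E^\mu_{ij}=\frac{d_\mu}{l!}\sum_{\tau\in S(l)}\phi^\mu_{ji}(\tau^{-1})\,V_\tau$$ as an operator on $(\mathbb C^d)^{\otimes n}$. For $\alpha\vdash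 n-2k$, $\mu,\nu\vdash n-k$, paths $r_{\mu/\alpha},r_{\nu/\alpha}$, and a fixed basis index $1_\alpha$ of $\alpha$, put $$F^{r_{\mu/\alpha}r_{\nu/\alpha}}_{i_\mu\ j_\nu}=\frac{m_\alpha}{\sqrt{m_\mu m_\nu}}\;E^\mu_{i_\mu\,(r_{\mu/\alpha},1_\alpha)}\;V^{(k)}\;E^\nu_{(r_{\nu/\alpha},1_\alpha)\,j_\nu},$$ and define the matrix elements of an operator $X$ in the operator basis $F$ by $$(X)^{r_{\mu/\alpha}r_{\nu/\alpha}}_{i_\mu\ j_\nu}=\frac1{m_\alpha}\operatorname{tr}\!\left[X\,F^{r_{\mu/\alpha}r_{\nu/\alpha}}_{i_\mu\ j_\nu}\right].$$ (If $m_\mu=0$ or $m_\nu=0$, i.e. if one of the irreps does not occur, division by $0$ is read as $0$, so that $F=0$, and both sides below vanish.) **Claim.** For all $\alpha,\mu,\nu,r_{\mu/\alpha},r_{\nu/\alpha}$ as above: 1. for $i_\mu=(r_{\mu/\beta},k_\beta)$ and $j_\nu=(r_{\nu/\gamma},l_\gamma)$ with $\beta,\gamma\vdash n-2k$, $$\bigl(V^{(k)}\bigr)^{r_{\mu/\alpha}r_{\nu/\alpha}}_{(r_{\mu/\beta},k_\beta)\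 (r_{\nu/\gamma},l_\gamma)}=\delta_{k_\beta l_\gamma}\,\delta^{r_{\mu/\alpha}r_{\mu/\beta}}\,\delta^{r_{\nu/\alpha}r_{\nu/\gamma}}\,\frac{\sqrt{m_\mu m_\nu}}{m_\alpha};$$ 2. for every $\tau\in S(n-k)$ and all $i_\mu,j_\nu$, $$\bigl(V_\tau\bigr)^{r_{\mu/\alpha}r_{\nu/\alpha}}_{i_\mu\ j_\nu}=\delta^{r_{\mu/\alpha}r_{\nu/\alpha}}\sqrt{\frac{m_\mu}{m_\nu}}\sum_{k_\mu}\delta_{k_\mu j_\nu}\,\phi^\mu_{k_\mu i_\mu}(\tau),$$ that is, for $m_\mu,m_\nu>0$, it is $\phi^\mu_{j_\mu i_\mu}(\tau)$ if $r_{\mu/\alpha}=r_{\nu/\alpha}$ (so $\mu=\nu$), and $0$ otherwise. -/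

import Mathlib

namespace PartialTransposeAlgebra

noncomputable section

/-! ### Young diagrams and paths in Young's lattice -/

/-- Young diagrams with `n` boxes. -/
abbrev Diagram (n : ℕ) : Type := {μ : YoungDiagram // μ.card = n}

/-- Downward paths in Young's lattice from the second diagram to the first one:
`YPath α μ` is the set of all chains from `μ` down to `α` in which each step removes one box. -/
inductive YPath (α : YoungDiagram) : YoungDiagram → Type
  | nil : YPath α α
  | cons {ν μ : YoungDiagram} (r : YPath α ν) (hle : ν ≤ μ) (hcard : μ.card = ν.card + 1) :
      YPath α μ

/-- Concatenation `(r_{μ/α}, l)`: follow `r` from `μ` down to `α`, and then `l` from `α` down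
to `β`. -/
def YPath.append {α β : YoungDiagram} : {μ : YoungDiagram} → YPath α μ → YPath β α → YPath β μ
  | _, .nil, l => l
  | _, .cons r hle hcard, l => .cons (r.append l) hle hcard

/-- The index set of the basis of the irrep `μ`: all paths in Young's lattice from `μ` down to the
empty diagram (equivalently, standard Young tableaux of shape `μ`). -/
abbrev Idx (μ : YoungDiagram) : Type := YPath ⊥ μ

/-- The basis index `i_μ = (r_{μ/α}, l_α)`. -/
abbrev idx {α μ : YoungDiagram} (r : YPath α μ) (l : Idx α) : Idx μ := r.append l

theorem finite_idx (μ : YoungDiagram) : Finite (Idx μ) := by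
  induction hn : μ.card using Nat.strong_induction_on generalizing μ with
  | _ n ih =>
    have hfin : Finite {ν : YoungDiagram // ν ≤ μ ∧ μ.card = ν.card + 1} := by
      refine Finite.of_injective
        (fun ν => (⟨ν.1.cells, Finset.mem_powerset.2 (fun x hx => ν.2.1 hx)⟩ :
          {s // s ∈ μ.cells.powerset})) ?_
      intro a b h
      exact Subtype.ext (YoungDiagram.ext (congrArg Subtype.val h))
    have hfin' : ∀ ν : {ν : YoungDiagram // ν ≤ μ ∧ μ.card = ν.card + 1}, Finite (Idx ν.1) :=
      fun ν => ih ν.1.card (by have := ν.2.2; omega) ν.1 rfl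
    refine Finite.of_surjective
      (α := PLift (⊥ = μ) ⊕ (Σ ν : {ν : YoungDiagram // ν ≤ μ ∧ μ.card = ν.card + 1}, Idx ν.1))
      (fun s => match s with
        | .inl h => h.down ▸ YPath.nil
        | .inr p => YPath.cons p.2 p.1.2.1 p.1.2.2) ?_
    intro p
    cases p with
    | nil => exact ⟨.inl ⟨rfl⟩, rfl⟩
    | cons r h1 h2 => exact ⟨.inr ⟨⟨_, h1, h2⟩, r⟩, rfl⟩

instance (μ : YoungDiagram) : Fintype (Idx μ) := @Fintype.ofFinite _ (finite_idx μ)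

instance (μ : YoungDiagram) : DecidableEq (Idx μ) := Classical.decEq _

open Classical in
/-- Kronecker delta of two paths `r_{μ/α}` and `s_{ν/β}`: it is `1` if the two paths coincide
(in particular `μ = ν` and `α = β`), and `0` otherwise. -/
def pathDelta {α β μ ν : YoungDiagram} (r : YPath α μ) (s : YPath β ν) : ℂ :=
  if (⟨(α, μ), r⟩ : Σ p : YoungDiagram × YoungDiagram, YPath p.1 p.2) = ⟨(β, ν), s⟩ then 1 else 0

/-! ### Irreducible representations of the symmetric groups in PRIR form -/

/-- The representation on column vectors given by a matrix representation. -/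
def matRep {G ι : Type*} [Group G] [Fintype ι] [DecidableEq ι] (M : G →* Matrix ι ι ℂ) :
    Representation ℂ G (ι → ℂ) :=
  (Matrix.toLinAlgEquiv' : Matrix ι ι ℂ ≃ₐ[ℂ] _).toAlgHom.toMonoidHom.comp M

/-- The embedding `S(l) ⊆ S(n)`, where `S(l)` permutes the first `l` points. -/
def extendPerm {l n : ℕ} (h : l ≤ n) (τ : Equiv.Perm (Fin l)) : Equiv.Perm (Fin n) :=
  τ.viaEmbedding (Fin.castLEEmb h)

/-- A choice, for every Young diagram `μ` with `n` boxes and every `n`, of a unitary matrix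
representation of `S(n)`, with rows and columns indexed by the paths from `μ` to the empty
diagram. -/
abbrev RepFamily : Type :=
  (n : ℕ) → (μ : Diagram n) → Equiv.Perm (Fin n) →* Matrix.unitaryGroup (Idx μ.1) ℂ

/-- The matrix-valued homomorphism underlying `φ^μ`. -/
def RepFamily.mat (φ : RepFamily) {n : ℕ} (μ : Diagram n) :
    Equiv.Perm (Fin n) →* Matrix (Idx μ.1) (Idx μ.1) ℂ :=
  (Submonoid.subtype _).comp (φ n μ)

/-- The family `φ` consists of the (unitary) irreps of the symmetric groups, labelled by Young
diagrams, in partially reduced (PRIR) form. -/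
structure IsPRIR (φ : RepFamily) : Prop where
  /-- every `φ^μ` is irreducible -/
  irreducible : ∀ (n : ℕ) (μ : Diagram n), (matRep (φ.mat μ)).IsIrreducible
  /-- different diagrams label inequivalent irreps -/
  inequivalent : ∀ (n : ℕ) (μ ν : Diagram n),
    Nonempty ((matRep (φ.mat μ)).Equiv (matRep (φ.mat ν))) → μ = ν
  /-- `φ^μ` restricted to `S(l)` is block diagonal, with one block for each path `r_{μ/α}`, and
  this block is `φ^α`: the diagonal blocks -/
  restrict_same : ∀ (l n : ℕ) (h : l ≤ n) (μ : Diagram n) (α : Diagram l) (r : YPath α.1 μ.1)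
    (κ : Equiv.Perm (Fin l)) (i j : Idx α.1),
    φ.mat μ (extendPerm h κ) (idx r i) (idx r j) = φ.mat α κ i j
  /-- the off-diagonal blocks -/
  restrict_ne : ∀ (l n : ℕ) (h : l ≤ n) (μ : Diagram n) (α β : Diagram l) (r : YPath α.1 μ.1)
    (s : YPath β.1 μ.1), pathDelta r s = 0 →
    ∀ (κ : Equiv.Perm (Fin l)) (i : Idx α.1) (j : Idx β.1),
      φ.mat μ (extendPerm h κ) (idx r i) (idx s j) = 0

/-! ### Operators on `(ℂ^d)^{⊗ n}` -/

/-- Operators on `(ℂ^d)^{⊗ n}`, as matrices in the product basis `|x_1 ⋯ x_n⟩`. -/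
abbrev Op (d n : ℕ) : Type := Matrix (Fin n → Fin d) (Fin n → Fin d) ℂ

/-- The permutation operators
`V_σ |x_1 ⋯ x_n⟩ = |x_{σ⁻¹(1)} ⋯ x_{σ⁻¹(n)}⟩`. -/
def permOp (d n : ℕ) : Equiv.Perm (Fin n) →* Op d n where
  toFun σ := Matrix.of fun x y => if x = y ∘ ⇑σ⁻¹ then 1 else 0
  map_one' := by
    ext x y
    simp [Matrix.one_apply]
  map_mul' σ τ := by
    ext x y
    simp [Matrix.mul_apply, Function.comp_assoc, Equiv.Perm.coe_mul]

/-- Partial transposition with respect to the system `s`. -/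
def partialTranspose {d n : ℕ} (s : Fin n) (A : Op d n) : Op d n :=
  Matrix.of fun x y => A (Function.update x s (y s)) (Function.update y s (x s))

/-- `V^{(k)} = V_{n-2k+1,n}^{t_n} V_{n-2k+2,n-1}^{t_{n-1}} ⋯ V_{n-k,n-k+1}^{t_{n-k+1}}`,
where `n = m + 2k`. With systems numbered from `0`, the factor number `j < k` is the partially
transposed swap of the systems `m + j` and `n - 1 - j`. -/
def Vk (d m k : ℕ) : Op d (m + k + k) :=
  (List.ofFn fun j : Fin k =>
    partialTranspose (⟨m + k + k - 1 - j, by omega⟩ : Fin (m + k + k))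
      (permOp d (m + k + k)
        (Equiv.swap ⟨m + j, by omega⟩ ⟨m + k + k - 1 - j, by omega⟩))).prod

/-- The multiplicity `m_μ` of the irrep `φ^μ` of `S(n)` in `(ℂ^d)^{⊗ n}`. -/
def mult (φ : RepFamily) (d : ℕ) {n : ℕ} (μ : Diagram n) : ℕ :=
  Module.finrank ℂ (Representation.IntertwiningMap (matRep (φ.mat μ)) (matRep (permOp d n)))

/-- The operators `E_{ij}^μ = (d_μ / l!) ∑_{τ ∈ S(l)} φ^μ_{ji}(τ⁻¹) V_τ`, for `μ` with `l` boxes,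
acting on the first `l` of `n` systems (and as the identity on the others). -/
def opE (φ : RepFamily) (d : ℕ) {l n : ℕ} (h : l ≤ n) (μ : Diagram l) (i j : Idx μ.1) : Op d n :=
  ((Fintype.card (Idx μ.1) : ℂ) / (l.factorial : ℂ)) •
    ∑ τ : Equiv.Perm (Fin l), φ.mat μ τ⁻¹ j i • permOp d n (extendPerm h τ)

/-- The operators
`F^{r_{μ/α} r_{ν/α}}_{i_μ j_ν} = m_α / √(m_μ m_ν) · E_{i_μ 1_α}^{r_{μ/α}} V^{(k)} E_{1_α j_ν}^{r_{ν/α}}`,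
where `e` is the distinguished basis index `1_α` of the irrep `α`. -/
def opF (φ : RepFamily) (d : ℕ) {m k : ℕ} {α : Diagram m} {μ ν : Diagram (m + k)} (e : Idx α.1)
    (r : YPath α.1 μ.1) (r' : YPath α.1 ν.1) (i : Idx μ.1) (j : Idx ν.1) : Op d (m + k + k) :=
  (((mult φ d α : ℝ) / √((mult φ d μ : ℝ) * (mult φ d ν : ℝ)) : ℝ) : ℂ) •
    (opE φ d (Nat.le_add_right _ _) μ i (idx r e) * Vk d m k *
      opE φ d (Nat.le_add_right _ _) ν (idx r' e) j)

/-- The matrix element of `X` in the operator basis `F`: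
`(X)^{r_{μ/α} r_{ν/α}}_{i_μ j_ν} = (1 / m_α) tr [X F^{r_{μ/α} r_{ν/α}}_{i_μ j_ν}]`. -/
def matrixElement (φ : RepFamily) (d : ℕ) {m k : ℕ} {α : Diagram m} {μ ν : Diagram (m + k)}
    (e : Idx α.1) (X : Op d (m + k + k)) (r : YPath α.1 μ.1) (r' : YPath α.1 ν.1)
    (i : Idx μ.1) (j : Idx ν.1) : ℂ :=
  (1 / (mult φ d α : ℂ)) * (X * opF φ d e r r' i j).trace

end

end PartialTransposeAlgebra

open PartialTransposeAlgebra

/-! Let `J` be the map `pairing`, sending |a⟩ to ∑_b |a⟩|b⟩|b^rev⟩. Then V^(k) = J Jᵀ, and Jᵀ (A ⊗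
1) J is the partial trace tr_k A over the last k of the m + k systems on which A acts
(`transpose_pairing_mul_mul_pairing`). Hence tr[(A ⊗ 1) V^(k)] = tr A and tr[V^(k) (A ⊗ 1) V^(k) (B
⊗ 1)] = tr[tr_k A · tr_k B], so both claims become statements about matrix units on m + k systems.

Schur orthogonality gives the products of the matrix units, and their traces δ_{ij} m_μ
(`trace_matUnit`). This already yields the second claim: expand V_τ E^μ in matrix units and multiply
by E^ν.

The first claim also needs tr_k E^μ (`IsPRIR.exists_partialTrace_unitE`,
`IsPRIR.partialTrace_unitE_of_ne`). The partial trace commutes with left and right multiplication by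
operators on the first m systems, so by the PRIR form tr_k E^μ_{(s,p)(r,q)} transforms under S(m)
like E_{pq}. It also lies in the span of the V_κ, κ ∈ S(m). By Schur it is therefore zero when s and
r end in different diagrams, and otherwise c E^α_{pq}. Comparing traces gives c m_α = δ^{sr} m_μ. -/

namespace PartialTransposeAlgebra

open Matrix

set_option linter.unusedSectionVars false

/-! ### Schur's lemma and orthogonality relations for matrix irreps. -/

section MatrixUnits

variable {G ι κ A W : Type*} [Group G] [Fintype G] [Fintype ι] [DecidableEq ι] [Fintype κ]
  [DecidableEq κ] [Ring A] [Algebra ℂ A] [AddCommGroup W] [Module ℂ W]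

/-- The intertwining map given by a matrix. -/
noncomputable def intertwinerOfMatrix (M : G →* Matrix ι ι ℂ) (N : G →* Matrix κ κ ℂ)
    (X : Matrix ι κ ℂ) (hX : ∀ g, M g * X = X * N g) :
    Representation.IntertwiningMap (matRep N) (matRep M) where
  toLinearMap := Matrix.mulVecLin X
  isIntertwining' g := by
    refine LinearMap.ext fun v => ?_
    change X *ᵥ (N g *ᵥ v) = M g *ᵥ (X *ᵥ v)
    rw [Matrix.mulVec_mulVec, Matrix.mulVec_mulVec, hX]

theorem intertwinerOfMatrix_apply (M : G →* Matrix ι ι ℂ) (N : G →* Matrix κ κ ℂ)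
    (X : Matrix ι κ ℂ) (hX : ∀ g, M g * X = X * N g) (v : κ → ℂ) :
    intertwinerOfMatrix M N X hX v = X *ᵥ v := rfl

/-- Schur's lemma for matrices, inequivalent irreps. -/
theorem eq_zero_of_intertwines (M : G →* Matrix ι ι ℂ) (N : G →* Matrix κ κ ℂ)
    (hM : (matRep M).IsIrreducible) (hN : (matRep N).IsIrreducible)
    (hMN : ¬ Nonempty ((matRep N).Equiv (matRep M)))
    (X : Matrix ι κ ℂ) (hX : ∀ g, M g * X = X * N g) : X = 0 := by
  have : IsEmpty ((matRep N).Equiv (matRep M)) := not_nonempty_iff.1 hMN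
  have h : intertwinerOfMatrix M N X hX = 0 := Subsingleton.elim _ _
  refine Matrix.toLin'.injective (LinearMap.ext fun v => ?_)
  exact congrArg (fun T : Representation.IntertwiningMap (matRep N) (matRep M) => T v) h |>.trans
    (by simp)

/-- Schur's lemma for matrices, a single irrep. -/
theorem exists_scalar_of_intertwines (M : G →* Matrix ι ι ℂ) (hM : (matRep M).IsIrreducible)
    (X : Matrix ι ι ℂ) (hX : ∀ g, M g * X = X * M g) : ∃ c : ℂ, X = c • (1 : Matrix ι ι ℂ) := by
  obtain ⟨c, hc⟩ := (Representation.IsIrreducible.algebraMap_intertwiningMap_bijective_of_isAlgClosed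
    (ρ := matRep M)).2 (intertwinerOfMatrix M M X hX)
  refine ⟨c, Matrix.toLin'.injective (LinearMap.ext fun v => ?_)⟩
  have h := congrArg (fun T : Representation.IntertwiningMap (matRep M) (matRep M) => T v) hc
  simp only [intertwinerOfMatrix_apply] at h
  rw [Matrix.toLin'_apply, ← h, Matrix.toLin'_apply, Matrix.smul_mulVec, Matrix.one_mulVec]
  rw [Algebra.algebraMap_eq_smul_one]
  rfl

/-- Reindexing the group sum by left translation turns any matrix X into an intertwiner, the input
for Schur's lemma. -/
theorem average_intertwines (M : G →* Matrix ι ι ℂ) (N : G →* Matrix κ κ ℂ) (X : Matrix ι κ ℂ)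
    (g : G) : M g * (∑ h, M h * X * N h⁻¹) = (∑ h, M h * X * N h⁻¹) * N g := by
  rw [Matrix.mul_sum, Matrix.sum_mul]
  refine Fintype.sum_equiv (Equiv.mulLeft g) _ _ fun h => ?_
  simp only [Equiv.coe_mulLeft, map_mul, _root_.mul_inv_rev, Matrix.mul_assoc]
  rw [← map_mul N g⁻¹ g]
  simp

theorem average_single_apply (M : G →* Matrix ι ι ℂ) (N : G →* Matrix κ κ ℂ) (i j : ι)
    (k l : κ) : (∑ h, M h * Matrix.single j k (1 : ℂ) * N h⁻¹) i l =
      ∑ h, M h i j * N h⁻¹ k l := by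
  rw [Matrix.sum_apply]
  refine Finset.sum_congr rfl fun h _ => ?_
  rw [Matrix.mul_assoc, Matrix.mul_apply, Finset.sum_eq_single j]
  · simp
  · intro b _ hb
    rw [Matrix.mul_apply]
    simp [Ne.symm hb]
  · simp

/-- Orthogonality of the matrix elements of inequivalent irreps. -/
theorem sum_mul_inv_eq_zero (M : G →* Matrix ι ι ℂ) (N : G →* Matrix κ κ ℂ)
    (hM : (matRep M).IsIrreducible) (hN : (matRep N).IsIrreducible)
    (hMN : ¬ Nonempty ((matRep N).Equiv (matRep M))) (i j : ι) (k l : κ) :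
    ∑ g, M g i j * N g⁻¹ k l = 0 := by
  rw [← average_single_apply,
    eq_zero_of_intertwines M N hM hN hMN _ (average_intertwines M N _), Matrix.zero_apply]

/-- Orthogonality of the matrix elements of an irrep. -/
theorem card_div_card_mul_sum_mul_inv (M : G →* Matrix ι ι ℂ) (hM : (matRep M).IsIrreducible)
    (i j k l : ι) : (Fintype.card ι : ℂ) / (Fintype.card G : ℂ) * ∑ g, M g i j * M g⁻¹ k l =
      if i = l ∧ j = k then 1 else 0 := by
  have : Nonempty ι := ⟨i⟩
  have hι : (Fintype.card ι : ℂ) ≠ 0 := Nat.cast_ne_zero.2 Fintype.card_ne_zero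
  have hG : (Fintype.card G : ℂ) ≠ 0 := Nat.cast_ne_zero.2 Fintype.card_ne_zero
  obtain ⟨c, hc⟩ := exists_scalar_of_intertwines M hM _
    (average_intertwines M M (Matrix.single j k (1 : ℂ)))
  -- The Schur scalar is found by taking traces: by cyclicity every summand of the average has the
  -- trace of the elementary matrix, δ_{jk}.
  have ht : (Fintype.card G : ℂ) * (if j = k then 1 else 0) = c * Fintype.card ι := by
    have h := congrArg Matrix.trace hc
    rw [Matrix.trace_smul, Matrix.trace_one, Matrix.trace_sum, smul_eq_mul] at h
    rw [← h, Finset.sum_congr rfl (g := fun _ => if j = k then (1 : ℂ) else 0)]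
    · simp
    · intro g _
      rw [Matrix.mul_assoc, Matrix.trace_mul_comm, Matrix.mul_assoc, ← map_mul]
      split_ifs with hjk
      · subst hjk; simp
      · simp [Matrix.trace_single_eq_of_ne _ _ _ hjk]
  rw [← average_single_apply, hc, Matrix.smul_apply, Matrix.one_apply, smul_eq_mul]
  have hc' : c = (Fintype.card G : ℂ) * (if j = k then 1 else 0) / Fintype.card ι := by
    rw [ht]; field_simp
  rw [hc']
  by_cases h1 : i = l <;> by_cases h2 : j = k <;> simp [h1, h2]

/-! ### Matrix units of an irrep inside a representation. -/

/-- The matrix units `E_{ij}` of the irrep `M` in a representation `V`. -/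
noncomputable def matUnit (M : G →* Matrix ι ι ℂ) (V : G →* A) (i j : ι) : A :=
  ((Fintype.card ι : ℂ) / (Fintype.card G : ℂ)) • ∑ g, M g⁻¹ j i • V g

theorem rep_mul_matUnit (M : G →* Matrix ι ι ℂ) (V : G →* A) (g : G) (i j : ι) :
    V g * matUnit M V i j = ∑ k, M g k i • matUnit M V k j := by
  simp only [matUnit, mul_smul_comm, Finset.mul_sum, smul_comm _ ((Fintype.card ι : ℂ) / _)]
  rw [← Finset.smul_sum]
  congr 1
  simp only [Finset.smul_sum]
  rw [Finset.sum_comm]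
  refine Fintype.sum_equiv (Equiv.mulLeft g) _ _ fun h => ?_
  simp only [Equiv.coe_mulLeft, map_mul, _root_.mul_inv_rev, smul_smul]
  rw [← Finset.sum_smul]
  congr 1
  have : M h⁻¹ = M h⁻¹ * M g⁻¹ * M g := by rw [Matrix.mul_assoc, ← map_mul M g⁻¹ g]; simp
  rw [this, Matrix.mul_apply]
  exact Finset.sum_congr rfl fun k _ => by rw [mul_comm]; simp [← map_mul]

theorem matUnit_mul_rep (M : G →* Matrix ι ι ℂ) (V : G →* A) (g : G) (i j : ι) :
    matUnit M V i j * V g = ∑ k, M g j k • matUnit M V i k := by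
  simp only [matUnit, smul_mul_assoc, Finset.sum_mul, smul_comm _ ((Fintype.card ι : ℂ) / _)]
  rw [← Finset.smul_sum]
  congr 1
  simp only [Finset.smul_sum]
  rw [Finset.sum_comm]
  refine Fintype.sum_equiv (Equiv.mulRight g) _ _ fun h => ?_
  simp only [Equiv.coe_mulRight, map_mul, _root_.mul_inv_rev, smul_smul]
  rw [← Finset.sum_smul]
  congr 1
  have : M h⁻¹ j i = (M g * (M g⁻¹ * M h⁻¹)) j i := by
    rw [← Matrix.mul_assoc, ← map_mul M g g⁻¹]; simp
  rw [this, Matrix.mul_apply]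

/-- Matrix units act on a family of vectors that transforms like the columns of the irrep. -/
theorem map_matUnit_of_columns (M : G →* Matrix ι ι ℂ) (hM : (matRep M).IsIrreducible)
    (V : G →* A) (X : ι → W) (k : ι) (L : A →ₗ[ℂ] W) (hL : ∀ g, L (V g) = ∑ l, M g l k • X l)
    (i j : ι) : L (matUnit M V i j) = if j = k then X i else 0 := by
  simp only [matUnit, map_smul, map_sum, hL, Finset.smul_sum, smul_smul]
  rw [Finset.sum_comm]
  simp only [← Finset.sum_smul]
  have h : ∀ l, ∑ g, (Fintype.card ι : ℂ) / (Fintype.card G : ℂ) * (M g⁻¹ j i * M g l k) =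
      if l = i ∧ k = j then 1 else 0 := fun l => by
    rw [← card_div_card_mul_sum_mul_inv M hM, Finset.mul_sum]
    exact Finset.sum_congr rfl fun g _ => by rw [mul_comm (M g⁻¹ j i)]
  simp only [← mul_assoc] at h ⊢
  simp only [h, ite_smul, one_smul, zero_smul]
  by_cases hk : k = j <;> simp [hk, eq_comm]

theorem map_matUnit_of_rows (M : G →* Matrix ι ι ℂ) (hM : (matRep M).IsIrreducible)
    (V : G →* A) (X : ι → W) (k : ι) (L : A →ₗ[ℂ] W) (hL : ∀ g, L (V g) = ∑ l, M g k l • X l)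
    (i j : ι) : L (matUnit M V i j) = if i = k then X j else 0 := by
  simp only [matUnit, map_smul, map_sum, hL, Finset.smul_sum, smul_smul]
  rw [Finset.sum_comm]
  simp only [← Finset.sum_smul]
  have h : ∀ l, ∑ g, (Fintype.card ι : ℂ) / (Fintype.card G : ℂ) * (M g⁻¹ j i * M g k l) =
      if k = i ∧ l = j then 1 else 0 := fun l => by
    rw [← card_div_card_mul_sum_mul_inv M hM, Finset.mul_sum]
    exact Finset.sum_congr rfl fun g _ => by rw [mul_comm (M g⁻¹ j i)]
  simp only [← mul_assoc] at h ⊢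
  simp only [h, ite_smul, one_smul, zero_smul]
  by_cases hk : k = i <;> simp [hk, eq_comm]

/-- The coefficient of each X l is an orthogonality sum between inequivalent irreps. -/
theorem map_matUnit_eq_zero (M : G →* Matrix ι ι ℂ) (hM : (matRep M).IsIrreducible)
    (N : G →* Matrix κ κ ℂ) (hN : (matRep N).IsIrreducible)
    (hMN : ¬ Nonempty ((matRep M).Equiv (matRep N)))
    (V : G →* A) (X : κ → W) (k : κ) (L : A →ₗ[ℂ] W) (hL : ∀ g, L (V g) = ∑ l, N g l k • X l)
    (i j : ι) : L (matUnit M V i j) = 0 := by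
  simp only [matUnit, map_smul, map_sum, hL, Finset.smul_sum, smul_smul]
  rw [Finset.sum_comm]
  simp only [← Finset.sum_smul]
  refine Finset.sum_eq_zero fun l _ => ?_
  have h : ∑ g, (Fintype.card ι : ℂ) / (Fintype.card G : ℂ) * M g⁻¹ j i * N g l k = 0 := by
    rw [← mul_zero ((Fintype.card ι : ℂ) / (Fintype.card G : ℂ)),
      ← sum_mul_inv_eq_zero N M hN hM hMN l k j i, Finset.mul_sum]
    exact Finset.sum_congr rfl fun g _ => by ring
  rw [h, zero_smul]

theorem matUnit_mul_matUnit (M : G →* Matrix ι ι ℂ) (hM : (matRep M).IsIrreducible)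
    (V : G →* A) (i j k l : ι) :
    matUnit M V i j * matUnit M V k l = if j = k then matUnit M V i l else 0 :=
  map_matUnit_of_columns M hM V (fun i => matUnit M V i l) k (LinearMap.mulRight ℂ _)
    (fun g => rep_mul_matUnit M V g k l) i j

theorem matUnit_mul_matUnit_eq_zero (M : G →* Matrix ι ι ℂ) (hM : (matRep M).IsIrreducible)
    (N : G →* Matrix κ κ ℂ) (hN : (matRep N).IsIrreducible)
    (hMN : ¬ Nonempty ((matRep M).Equiv (matRep N))) (V : G →* A) (i j : ι) (k l : κ) :
    matUnit M V i j * matUnit N V k l = 0 :=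
  map_matUnit_eq_zero M hM N hN hMN V (fun i => matUnit N V i l) k (LinearMap.mulRight ℂ _)
    (fun g => rep_mul_matUnit N V g k l) i j

/-! ### Multiplicities as traces of matrix units. -/

/-- The multiplicity space of an irrep is the range of a diagonal matrix unit. -/
theorem finrank_intertwiningMap_eq_finrank_range (M : G →* Matrix ι ι ℂ)
    (hM : (matRep M).IsIrreducible) (V : G →* Matrix κ κ ℂ) (i : ι) :
    Module.finrank ℂ (Representation.IntertwiningMap (matRep M) (matRep V)) =
      Module.finrank ℂ (LinearMap.range (Matrix.toLin' (matUnit M V i i))) := by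
  -- The images T e_j transform like the columns of M. So T is determined by T e_i, and that vector
  -- is fixed by E_ii.
  have key : ∀ (T : Representation.IntertwiningMap (matRep M) (matRep V)) (j : ι),
      matUnit M V j i *ᵥ T (Pi.single i 1) = T (Pi.single j 1) := by
    intro T j
    have h := map_matUnit_of_columns M hM V (fun j => T (Pi.single j 1)) i
      ((LinearMap.applyₗ (T (Pi.single i 1))).comp (Matrix.toLin' (R := ℂ) (m := κ) (n := κ)).toLinearMap)
      (fun g => ?_) j i
    · simpa using h
    · have h1 : V g *ᵥ T (Pi.single i 1) = T (M g *ᵥ Pi.single i 1) :=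
        (congrArg (fun f => f (Pi.single i 1)) (T.isIntertwining' g)).symm
      have h2 : M g *ᵥ Pi.single i (1 : ℂ) = ∑ l, M g l i • Pi.single l (1 : ℂ) := by
        ext x
        simp [Finset.sum_apply, Pi.single_apply]
      simp [h1, h2, map_sum, map_smul]
  let ev : Representation.IntertwiningMap (matRep M) (matRep V) →ₗ[ℂ]
      LinearMap.range (Matrix.toLin' (matUnit M V i i)) :=
    { toFun := fun T => ⟨T (Pi.single i 1), ⟨T (Pi.single i 1), by simpa using key T i⟩⟩
      map_add' := fun S T => rfl
      map_smul' := fun c T => rfl }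
  refine (LinearEquiv.ofBijective ev ⟨?_, ?_⟩).finrank_eq
  · intro S T hST
    have h0 : S (Pi.single i 1) = T (Pi.single i 1) := congrArg Subtype.val hST
    refine Representation.IntertwiningMap.ext ?_
    refine LinearMap.pi_ext' fun j => LinearMap.ext_ring ?_
    change S (Pi.single j 1) = T (Pi.single j 1)
    rw [← key S, ← key T, h0]
  · rintro ⟨_, w, rfl⟩
    set v := Matrix.toLin' (matUnit M V i i) w with hv
    -- The preimage of v is forced by `key`: it must send e_j to E_ji v.
    let T : (ι → ℂ) →ₗ[ℂ] (κ → ℂ) := Fintype.linearCombination ℂ fun j => matUnit M V j i *ᵥ v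
    have hT : ∀ f, T f = ∑ j, f j • (matUnit M V j i *ᵥ v) := fun f =>
      Fintype.linearCombination_apply ℂ _ f
    refine ⟨⟨T, fun g => LinearMap.ext fun f => ?_⟩, Subtype.ext ?_⟩
    · change T (M g *ᵥ f) = V g *ᵥ T f
      rw [hT, hT, Matrix.mulVec_sum]
      simp only [Matrix.mulVec_smul, Matrix.mulVec_mulVec, rep_mul_matUnit, Matrix.sum_mulVec,
        Matrix.smul_mulVec, Finset.smul_sum, Matrix.mulVec, dotProduct, Finset.sum_smul]
      rw [Finset.sum_comm]
      refine Finset.sum_congr rfl fun k _ => Finset.sum_congr rfl fun j _ => ?_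
      rw [smul_smul, mul_comm]
    · change T (Pi.single i 1) = v
      rw [hT, Finset.sum_eq_single i]
      · simp [hv, Matrix.mulVec_mulVec, matUnit_mul_matUnit M hM]
      · intro j _ hj
        simp [hj]
      · simp

/-- The trace of a matrix unit is the multiplicity of the irrep. -/
theorem trace_matUnit (M : G →* Matrix ι ι ℂ) (hM : (matRep M).IsIrreducible)
    (V : G →* Matrix κ κ ℂ) (i j : ι) : (matUnit M V i j).trace =
      if i = j then
        (Module.finrank ℂ (Representation.IntertwiningMap (matRep M) (matRep V)) : ℂ) else 0 := by
  split_ifs with hij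
  · subst hij
    rw [finrank_intertwiningMap_eq_finrank_range M hM V i, ← Matrix.trace_toLin'_eq]
    refine LinearMap.IsProj.trace ⟨fun x => ⟨x, rfl⟩, ?_⟩
    rintro _ ⟨w, rfl⟩
    rw [Matrix.toLin'_apply, Matrix.toLin'_apply, Matrix.mulVec_mulVec,
      matUnit_mul_matUnit M hM, if_pos rfl]
  -- E_ij = E_ii E_ij, and by cyclicity its trace is that of E_ij E_ii, which is zero for i ≠ j.
  · have h := matUnit_mul_matUnit M hM V i i i j
    rw [if_pos rfl] at h
    rw [← h, Matrix.trace_mul_comm, matUnit_mul_matUnit M hM, if_neg (Ne.symm hij),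
      Matrix.trace_zero]

end MatrixUnits

end PartialTransposeAlgebra

namespace PartialTransposeAlgebra

open Matrix

noncomputable section

/-! ### Operators on the first systems, partial traces -/

/-- The operator `A ⊗ 1` acting on the first `N` of `N + k` systems. -/
def extendOp {d N : ℕ} (k : ℕ) (A : Op d N) : Op d (N + k) :=
  Matrix.reindexAlgEquiv ℂ ℂ (Fin.appendEquiv N k)
    (Matrix.kronecker A (1 : Matrix (Fin k → Fin d) (Fin k → Fin d) ℂ))

theorem extendOp_append {d N k : ℕ} (A : Op d N) (a a' : Fin N → Fin d) (b b' : Fin k → Fin d) :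
    extendOp k A (Fin.append a b) (Fin.append a' b') = if b = b' then A a a' else 0 := by
  have h : ∀ (a : Fin N → Fin d) (b : Fin k → Fin d),
      (Fin.appendEquiv N k).symm (Fin.append a b) = (a, b) := fun a b =>
    (Fin.appendEquiv N k).symm_apply_apply (a, b)
  simp [extendOp, h, Matrix.one_apply]

theorem op_ext {d N k : ℕ} {A B : Op d (N + k)}
    (h : ∀ (a : Fin N → Fin d) (b : Fin k → Fin d) (a' : Fin N → Fin d) (b' : Fin k → Fin d),
      A (Fin.append a b) (Fin.append a' b') = B (Fin.append a b) (Fin.append a' b')) : A = B := by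
  ext x y
  obtain ⟨⟨a, b⟩, rfl⟩ := (Fin.appendEquiv N k).surjective x
  obtain ⟨⟨a', b'⟩, rfl⟩ := (Fin.appendEquiv N k).surjective y
  exact h a b a' b'

theorem sum_append {d N k : ℕ} {R : Type*} [AddCommMonoid R] (f : (Fin (N + k) → Fin d) → R) :
    ∑ x, f x = ∑ a : Fin N → Fin d, ∑ b : Fin k → Fin d, f (Fin.append a b) := by
  rw [← (Fin.appendEquiv N k).sum_comp, Fintype.sum_prod_type]
  rfl

theorem extendOp_mul {d N : ℕ} (k : ℕ) (A B : Op d N) :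
    extendOp k (A * B) = extendOp k A * extendOp k B := by
  rw [extendOp, extendOp, extendOp, ← map_mul, Matrix.kronecker, ← Matrix.mul_kronecker_mul,
    Matrix.mul_one]

theorem extendOp_add {d N : ℕ} (k : ℕ) (A B : Op d N) :
    extendOp k (A + B) = extendOp k A + extendOp k B :=
  op_ext fun a b a' b' => by
    rw [Matrix.add_apply]
    simp only [extendOp_append, Matrix.add_apply]
    split_ifs <;> simp

theorem extendOp_smul {d N : ℕ} (k : ℕ) (c : ℂ) (A : Op d N) :
    extendOp k (c • A) = c • extendOp k A :=
  op_ext fun a b a' b' => by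
    rw [Matrix.smul_apply]
    simp only [extendOp_append, Matrix.smul_apply]
    split_ifs <;> simp

/-- `extendOp` as a linear map. -/
def extendOpₗ (d N k : ℕ) : Op d N →ₗ[ℂ] Op d (N + k) where
  toFun := extendOp k
  map_add' := extendOp_add k
  map_smul' := extendOp_smul k

/-- The inclusion `S(l) ⊆ S(n)` as a homomorphism. -/
def extendPermHom {l n : ℕ} (h : l ≤ n) : Equiv.Perm (Fin l) →* Equiv.Perm (Fin n) :=
  Equiv.Perm.viaEmbeddingHom (Fin.castLEEmb h)

theorem extendPermHom_apply {l n : ℕ} (h : l ≤ n) (τ : Equiv.Perm (Fin l)) :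
    extendPermHom h τ = extendPerm h τ := rfl

theorem extendPerm_castAdd {N k : ℕ} (h : N ≤ N + k) (τ : Equiv.Perm (Fin N)) (i : Fin N) :
    extendPerm h τ (Fin.castAdd k i) = Fin.castAdd k (τ i) :=
  τ.viaEmbedding_apply (Fin.castLEEmb h) i

theorem extendPerm_natAdd {N k : ℕ} (h : N ≤ N + k) (τ : Equiv.Perm (Fin N)) (i : Fin k) :
    extendPerm h τ (Fin.natAdd N i) = Fin.natAdd N i := by
  refine τ.viaEmbedding_apply_of_notMem (Fin.castLEEmb h) _ ?_
  rintro ⟨j, hj⟩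
  have := congrArg Fin.val hj
  simp at this
  omega

theorem append_comp_extendPerm {d N k : ℕ} (h : N ≤ N + k) (τ : Equiv.Perm (Fin N))
    (a : Fin N → Fin d) (b : Fin k → Fin d) :
    Fin.append a b ∘ ⇑(extendPerm h τ) = Fin.append (a ∘ ⇑τ) b := by
  funext x
  refine Fin.addCases (fun i => ?_) (fun i => ?_) x
  · simp [extendPerm_castAdd]
  · simp [extendPerm_natAdd]

theorem permOp_apply {d n : ℕ} (σ : Equiv.Perm (Fin n)) (x y : Fin n → Fin d) :
    permOp d n σ x y = if x = y ∘ ⇑σ⁻¹ then 1 else 0 := rfl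

theorem append_inj {d N k : ℕ} {a a' : Fin N → Fin d} {b b' : Fin k → Fin d} :
    Fin.append a b = Fin.append a' b' ↔ a = a' ∧ b = b' := by
  have h := (Fin.appendEquiv (α := Fin d) N k).injective.eq_iff (a := (a, b)) (b := (a', b'))
  rw [Prod.mk.injEq] at h
  exact h

theorem permOp_extendPerm {d N k : ℕ} (h : N ≤ N + k) (τ : Equiv.Perm (Fin N)) :
    permOp d (N + k) (extendPerm h τ) = extendOp k (permOp d N τ) := by
  refine op_ext fun a b a' b' => ?_
  rw [extendOp_append, permOp_apply, permOp_apply, ← extendPermHom_apply, ← map_inv,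
    extendPermHom_apply, append_comp_extendPerm]
  simp only [append_inj]
  by_cases h1 : b = b' <;> simp [h1]

/-- The partial trace over the last `k` of `N + k` systems. -/
def partialTrace (d N k : ℕ) : Op d (N + k) →ₗ[ℂ] Op d N where
  toFun A := Matrix.of fun a a' => ∑ b, A (Fin.append a b) (Fin.append a' b)
  map_add' A B := by
    ext a a'
    simp [Finset.sum_add_distrib]
  map_smul' c A := by
    ext a a'
    simp [Finset.mul_sum]

theorem partialTrace_apply {d N k : ℕ} (A : Op d (N + k)) (a a' : Fin N → Fin d) :
    partialTrace d N k A a a' = ∑ b, A (Fin.append a b) (Fin.append a' b) := rfl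

theorem trace_partialTrace {d N k : ℕ} (A : Op d (N + k)) :
    (partialTrace d N k A).trace = A.trace := by
  simp only [Matrix.trace, Matrix.diag, partialTrace_apply]
  rw [sum_append]

theorem partialTrace_extendOp_mul {d N k : ℕ} (B : Op d N) (A : Op d (N + k)) :
    partialTrace d N k (extendOp k B * A) = B * partialTrace d N k A := by
  ext a a'
  simp only [Matrix.mul_apply, partialTrace_apply, sum_append, extendOp_append, ite_mul, zero_mul,
    Finset.sum_ite_eq, Finset.mem_univ, if_true, Finset.mul_sum]
  exact Finset.sum_comm

theorem partialTrace_mul_extendOp {d N k : ℕ} (B : Op d N) (A : Op d (N + k)) :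
    partialTrace d N k (A * extendOp k B) = partialTrace d N k A * B := by
  ext a a'
  simp only [Matrix.mul_apply, partialTrace_apply, sum_append, extendOp_append, mul_ite, mul_zero,
    Finset.sum_ite_eq', Finset.mem_univ, if_true, Finset.sum_mul]
  exact Finset.sum_comm

/-! ### Partial traces of permutation operators -/

theorem partialTrace_zero_eq {d N : ℕ} (A : Op d (N + 0)) : partialTrace d N 0 A = A := by
  ext a a'
  rw [partialTrace_apply, Fintype.sum_unique]
  have h : ∀ a : Fin N → Fin d, Fin.append a (default : Fin 0 → Fin d) = a := fun a => by
    rw [Subsingleton.elim (default : Fin 0 → Fin d) Fin.elim0, Fin.append_elim0]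
    rfl
  exact congrArg₂ A (h a) (h a')

theorem partialTrace_succ {d N k : ℕ} (A : Op d (N + (k + 1))) :
    partialTrace d N (k + 1) A = partialTrace d N k (partialTrace d (N + k) 1 A) := by
  ext a a'
  simp only [partialTrace_apply]
  rw [sum_append]
  refine Finset.sum_congr rfl fun b _ => Finset.sum_congr rfl fun t _ => ?_
  have h : ∀ a : Fin N → Fin d, Fin.append a (Fin.append b t) = Fin.append (Fin.append a b) t :=
    fun a => (Fin.append_assoc a b t).symm ▸ rfl
  exact congrArg₂ A (h a) (h a')

theorem partialTrace_one_swap {d N : ℕ} (i : Fin N) :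
    partialTrace d N 1 (permOp d (N + 1) (Equiv.swap (Fin.castAdd 1 i) (Fin.natAdd N 0))) = 1 := by
  ext a a'
  have h : ∀ b : Fin 1 → Fin d, (Fin.append a b = Fin.append a' b ∘
      ⇑(Equiv.swap (Fin.castAdd 1 i) (Fin.natAdd N (0 : Fin 1)))⁻¹) ↔
      b = (fun _ => a i) ∧ a = a' := by
    intro b
    rw [Equiv.swap_inv]
    constructor
    · intro h
      have h1 : a i = b 0 := by
        have := congrFun h (Fin.castAdd 1 i)
        simpa only [Function.comp, Equiv.swap_apply_left, Fin.append_left, Fin.append_right]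
          using this
      have h2 : b 0 = a' i := by
        have := congrFun h (Fin.natAdd N 0)
        simpa only [Function.comp, Equiv.swap_apply_right, Fin.append_left, Fin.append_right]
          using this
      refine ⟨funext fun x => by rw [Subsingleton.elim x 0, h1], funext fun j => ?_⟩
      by_cases hj : j = i
      · rw [hj, h1, h2]
      · have := congrFun h (Fin.castAdd 1 j)
        rw [Function.comp, Equiv.swap_apply_of_ne_of_ne, Fin.append_left, Fin.append_left] at this
        · exact this
        · simpa using hj
        · intro h; have := congrArg Fin.val h; simp at this; omega
    · rintro ⟨rfl, rfl⟩
      funext x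
      by_cases h1 : x = Fin.castAdd 1 i
      · subst h1
        simp only [Function.comp, Equiv.swap_apply_left, Fin.append_left, Fin.append_right]
      · by_cases h2 : x = Fin.natAdd N 0
        · subst h2
          simp only [Function.comp, Equiv.swap_apply_right, Fin.append_left, Fin.append_right]
        · simp only [Function.comp, Equiv.swap_apply_of_ne_of_ne h1 h2]
  simp only [partialTrace_apply, permOp_apply, h, Matrix.one_apply]
  by_cases h' : a = a' <;> simp [h']

theorem partialTrace_one_one {d N : ℕ} : partialTrace d N 1 (1 : Op d (N + 1)) = (d : ℂ) • 1 := by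
  ext a a'
  simp only [partialTrace_apply, Matrix.one_apply, append_inj, and_true, Matrix.smul_apply]
  simp

/-- A permutation fixing the last point comes from a permutation of the other ones. -/
theorem exists_extendPerm_of_last {N : ℕ} (σ : Equiv.Perm (Fin (N + 1)))
    (hσ : σ (Fin.natAdd N 0) = Fin.natAdd N 0) :
    ∃ τ : Equiv.Perm (Fin N), σ = extendPerm (Nat.le_add_right N 1) τ := by
  have hinv : σ⁻¹ (Fin.natAdd N 0) = Fin.natAdd N 0 := by
    rw [Equiv.Perm.inv_eq_iff_eq, hσ]
  have key : ∀ ρ : Equiv.Perm (Fin (N + 1)), ρ (Fin.natAdd N 0) = Fin.natAdd N 0 →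
      ∀ i : Fin N, ∃ j : Fin N, ρ (Fin.castAdd 1 i) = Fin.castAdd 1 j := by
    intro ρ hρ i
    refine Fin.addCases (motive := fun x => ρ (Fin.castAdd 1 i) = x → ∃ j : Fin N, ρ (Fin.castAdd 1 i) = Fin.castAdd 1 j)
      (fun j hj => ⟨j, hj⟩) (fun j hj => ?_) (ρ (Fin.castAdd 1 i)) rfl
    rw [Subsingleton.elim j 0, ← hρ] at hj
    have := congrArg Fin.val (ρ.injective hj)
    simp at this
    omega
  choose f hf using key σ hσ
  choose g hg using key σ⁻¹ hinv
  have inj : Function.Injective (Fin.castAdd 1 : Fin N → Fin (N + 1)) := Fin.castAdd_injective N 1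
  refine ⟨⟨f, g, fun i => inj ?_, fun i => inj ?_⟩, ?_⟩
  · rw [← hg, ← hf]; simp
  · rw [← hf, ← hg]; simp
  · ext x : 1
    refine Fin.addCases (fun i => ?_) (fun i => ?_) x
    · rw [extendPerm_castAdd, hf]; rfl
    · rw [extendPerm_natAdd, Subsingleton.elim i 0, hσ]

/-- The span of the permutation operators. -/
abbrev permSpan (d n : ℕ) : Submodule ℂ (Op d n) := Submodule.span ℂ (Set.range (permOp d n))

/-- Either σ fixes the last point, and tracing it out gives a factor d, or σ is a transposition
involving the last point times a permutation of the others, and the transposition traces to the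
identity. -/
theorem partialTrace_one_permOp_mem {d N : ℕ} (σ : Equiv.Perm (Fin (N + 1))) :
    partialTrace d N 1 (permOp d (N + 1) σ) ∈ permSpan d N := by
  refine Fin.addCases (motive := fun x => σ (Fin.natAdd N 0) = x → _) (fun i hi => ?_)
    (fun i hi => ?_) (σ (Fin.natAdd N 0)) rfl
  · obtain ⟨τ, hτ⟩ := exists_extendPerm_of_last
      (Equiv.swap (Fin.castAdd 1 i) (Fin.natAdd N 0) * σ) (by simp [hi])
    have h : σ = Equiv.swap (Fin.castAdd 1 i) (Fin.natAdd N 0) *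
        extendPerm (Nat.le_add_right N 1) τ := by
      rw [← hτ, ← mul_assoc, Equiv.swap_mul_self, one_mul]
    rw [h, map_mul, permOp_extendPerm, partialTrace_mul_extendOp, partialTrace_one_swap, one_mul]
    exact Submodule.subset_span ⟨τ, rfl⟩
  · rw [Subsingleton.elim i 0] at hi
    obtain ⟨τ, rfl⟩ := exists_extendPerm_of_last σ hi
    rw [permOp_extendPerm, ← mul_one (extendOp 1 _), partialTrace_extendOp_mul,
      partialTrace_one_one, mul_smul_comm, mul_one]
    exact Submodule.smul_mem _ _ (Submodule.subset_span ⟨τ, rfl⟩)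

/-- Systems are traced out one at a time. Staying in the span is what later allows Schur's lemma to
be applied to partial traces of matrix units. -/
theorem partialTrace_mem_permSpan {d N : ℕ} (k : ℕ) {A : Op d (N + k)}
    (hA : A ∈ permSpan d (N + k)) : partialTrace d N k A ∈ permSpan d N := by
  induction k with
  | zero => rw [partialTrace_zero_eq]; exact hA
  | succ k ih =>
    rw [partialTrace_succ]
    refine ih ?_
    have hle : permSpan d (N + k + 1) ≤ (permSpan d (N + k)).comap (partialTrace d (N + k) 1) := by
      rw [permSpan, Submodule.span_le]
      rintro _ ⟨σ, rfl⟩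
      exact partialTrace_one_permOp_mem σ
    exact hle hA

/-! ### The operator `V^(k)` -/

/-- The partially transposed swap of the systems `a`, `b`. -/
theorem partialTranspose_swap_apply {d n : ℕ} {a b : Fin n} (hab : a ≠ b) (x y : Fin n → Fin d) :
    partialTranspose b (permOp d n (Equiv.swap a b)) x y =
      if x a = x b ∧ y a = y b ∧ ∀ c, c ≠ a → c ≠ b → x c = y c then 1 else 0 := by
  have h : (Function.update x b (y b) = Function.update y b (x b) ∘ ⇑(Equiv.swap a b)⁻¹) ↔
      (x a = x b ∧ y a = y b ∧ ∀ c, c ≠ a → c ≠ b → x c = y c) := by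
    rw [Equiv.swap_inv]
    constructor
    · intro h
      refine ⟨?_, ?_, fun c hca hcb => ?_⟩
      · simpa [hab] using congrFun h a
      · simpa [hab, eq_comm] using congrFun h b
      · simpa [hca, hcb, Equiv.swap_apply_of_ne_of_ne] using congrFun h c
    · rintro ⟨h1, h2, h3⟩
      funext c
      by_cases hca : c = a
      · subst hca; simp [hab, h1]
      by_cases hcb : c = b
      · subst hcb; simp [hab, h2]
      simp [hca, hcb, Equiv.swap_apply_of_ne_of_ne, h3]
  change (if _ then (1 : ℂ) else 0) = _
  simp only [h]

theorem prod_partialTranspose_swap_apply {d n : ℕ} : ∀ (k : ℕ) (f g : Fin k → Fin n),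
    Function.Injective f → Function.Injective g → (∀ i j, f i ≠ g j) →
    ∀ x y : Fin n → Fin d,
    (List.ofFn fun j => partialTranspose (g j) (permOp d n (Equiv.swap (f j) (g j)))).prod x y =
      if (∀ j, x (f j) = x (g j)) ∧ (∀ j, y (f j) = y (g j)) ∧
        ∀ c, (∀ j, c ≠ f j ∧ c ≠ g j) → x c = y c then 1 else 0 := by
  intro k
  induction k with
  | zero =>
    intro f g _ _ _ x y
    simp [Matrix.one_apply, funext_iff]
  | succ k ih =>
    intro f g hf hg hfg x y
    rw [List.ofFn_succ, List.prod_cons, Matrix.mul_apply]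
    have hf' : Function.Injective fun j : Fin k => f j.succ :=
      hf.comp (Fin.succ_injective k)
    have hg' : Function.Injective fun j : Fin k => g j.succ :=
      hg.comp (Fin.succ_injective k)
    simp only [ih _ _ hf' hg' (fun i j => hfg _ _), partialTranspose_swap_apply (hfg 0 0),
      mul_ite, mul_one, mul_zero, ← ite_and]
    have hff : ∀ j : Fin k, f j.succ ≠ f 0 := fun j h => Fin.succ_ne_zero j (hf h)
    have hgg : ∀ j : Fin k, g j.succ ≠ g 0 := fun j h => Fin.succ_ne_zero j (hg h)
    -- Only one intermediate index z contributes to the matrix product: it agrees with y on the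
    -- first pair and with x elsewhere.
    have hz : ∀ z : Fin n → Fin d,
        ((((∀ j : Fin k, z (f j.succ) = z (g j.succ)) ∧ (∀ j : Fin k, y (f j.succ) = y (g j.succ)) ∧
          ∀ c, (∀ j : Fin k, c ≠ f j.succ ∧ c ≠ g j.succ) → z c = y c)) ∧
          (x (f 0) = x (g 0) ∧ z (f 0) = z (g 0) ∧ ∀ c, c ≠ f 0 → c ≠ g 0 → x c = z c)) ↔
        (z = (fun c => if c = f 0 ∨ c = g 0 then y c else x c)) ∧
          ((∀ j, x (f j) = x (g j)) ∧ (∀ j, y (f j) = y (g j)) ∧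
        ∀ c, (∀ j, c ≠ f j ∧ c ≠ g j) → x c = y c) := by
      intro z
      constructor
      · rintro ⟨⟨h1, h2, h3⟩, h4, h5, h6⟩
        have e1 : z (f 0) = y (f 0) := h3 _ fun j => ⟨(hff j).symm, hfg _ _⟩
        have e2 : z (g 0) = y (g 0) := h3 _ fun j => ⟨(hfg _ _).symm, (hgg j).symm⟩
        refine ⟨funext fun c => ?_, fun j => ?_, fun j => ?_, fun c hc => ?_⟩
        · split_ifs with hc
          · rcases hc with rfl | rfl
            · exact e1
            · exact e2
          · push Not at hc
            exact (h6 c hc.1 hc.2).symm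
        · refine Fin.cases h4 (fun j => ?_) j
          rw [h6 _ (hff j) (hfg _ _), h6 _ (hfg _ _).symm (hgg j), h1]
        · refine Fin.cases ?_ h2 j
          rw [← e1, ← e2, h5]
        · rw [h6 c (hc 0).1 (hc 0).2, h3 c fun j => hc j.succ]
      · rintro ⟨rfl, h1, h2, h3⟩
        refine ⟨⟨fun j => ?_, fun j => h2 _, fun c hc => ?_⟩, h1 0, ?_, fun c hc hc' => ?_⟩
        · simp [hff j, hgg j, hfg, (hfg _ _).symm, h1]
        · dsimp only
          split_ifs with h
          · rfl
          · push Not at h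
            exact h3 c fun j => Fin.cases h hc j
        · simp [h2]
        · simp [hc, hc']
    simp only [hz, ite_and]
    rw [Finset.sum_ite_eq']
    simp

/-- The basis vector `|a⟩|b⟩|b^rev⟩`. -/
def pairedIndex {d m k : ℕ} (a : Fin m → Fin d) (b : Fin k → Fin d) : Fin (m + k + k) → Fin d :=
  Fin.append (Fin.append a b) (b ∘ Fin.rev)

/-- The map `|a⟩ ↦ ∑_b |a⟩|b⟩|b^rev⟩`, whose columns span the range of `V^(k)`. -/
def pairing (d m k : ℕ) : Matrix (Fin (m + k + k) → Fin d) (Fin m → Fin d) ℂ :=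
  Matrix.of fun x a => ∑ b, if x = pairedIndex a b then 1 else 0

theorem sum_pairing_mul {d m k : ℕ} (a : Fin m → Fin d) (f : (Fin (m + k + k) → Fin d) → ℂ) :
    ∑ x, pairing d m k x a * f x = ∑ b, f (pairedIndex a b) := by
  simp only [pairing, Matrix.of_apply, Finset.sum_mul]
  rw [Finset.sum_comm]
  simp

/-- The last k systems, on which the extended operator is the identity, force the two summed indices
b and b' to agree; this is exactly the partial trace. -/
theorem transpose_pairing_mul_mul_pairing {d m k : ℕ} (A : Op d (m + k)) :
    (pairing d m k)ᵀ * extendOp k A * pairing d m k = partialTrace d m k A := by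
  ext a a'
  simp only [Matrix.mul_apply, Matrix.transpose_apply, sum_pairing_mul]
  simp only [mul_comm _ (pairing d m k _ a'), sum_pairing_mul]
  have h : ∀ b b' : Fin k → Fin d, b ∘ Fin.rev = b' ∘ Fin.rev ↔ b = b' := fun b b' =>
    Fin.rev_surjective.injective_comp_right.eq_iff
  simp [pairedIndex, extendOp_append, partialTrace_apply, h]

theorem Vk_eq_pairing_mul_transpose (d m k : ℕ) :
    Vk d m k = pairing d m k * (pairing d m k)ᵀ := by
  have hV : ∀ x y, Vk d m k x y =
      if (∀ j : Fin k, x (Fin.castAdd k (Fin.natAdd m j)) = x (Fin.natAdd (m + k) j.rev)) ∧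
        (∀ j : Fin k, y (Fin.castAdd k (Fin.natAdd m j)) = y (Fin.natAdd (m + k) j.rev)) ∧
        ∀ c, (∀ j : Fin k, c ≠ Fin.castAdd k (Fin.natAdd m j) ∧ c ≠ Fin.natAdd (m + k) j.rev) →
          x c = y c then 1 else 0 := by
    intro x y
    rw [← prod_partialTranspose_swap_apply k
      (fun j => Fin.castAdd k (Fin.natAdd m j)) (fun j => Fin.natAdd (m + k) j.rev)]
    -- The pairs in V^(k) are nested, so system m + j meets the last block in reversed order.
    · have h : ∀ j : Fin k, Fin.natAdd (m + k) j.rev = ⟨m + k + k - 1 - j, by omega⟩ := fun j => by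
        ext
        simp
        omega
      simp only [h]
      rfl
    · intro i j h
      simpa using h
    · intro i j h
      simpa using h
    · intro i j h
      have := congrArg Fin.val h
      simp at this
      omega
  refine op_ext fun ab c ab' c' => ?_
  obtain ⟨⟨a, b⟩, rfl⟩ := (Fin.appendEquiv m k).surjective ab
  obtain ⟨⟨a', b'⟩, rfl⟩ := (Fin.appendEquiv m k).surjective ab'
  change Vk d m k (Fin.append (Fin.append a b) c) (Fin.append (Fin.append a' b') c') = 
    (pairing d m k * (pairing d m k)ᵀ) (Fin.append (Fin.append a b) c) (Fin.append (Fin.append a' b') c')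
  have hJ : ∀ (a : Fin m → Fin d) (b c : Fin k → Fin d) (a' : Fin m → Fin d),
      pairing d m k (Fin.append (Fin.append a b) c) a' =
        if c = b ∘ Fin.rev then if a = a' then 1 else 0 else 0 := by
    intro a b c a'
    simp only [pairing, Matrix.of_apply, pairedIndex, append_inj]
    by_cases ha : a = a'
    · simp only [ha, true_and, if_true, ite_and]
      simp
    · simp [ha]
  rw [hV, Matrix.mul_apply]
  simp only [Matrix.transpose_apply, hJ]
  have h : ((∀ j : Fin k, Fin.append (Fin.append a b) c (Fin.castAdd k (Fin.natAdd m j)) =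
          Fin.append (Fin.append a b) c (Fin.natAdd (m + k) j.rev)) ∧
        (∀ j : Fin k, Fin.append (Fin.append a' b') c' (Fin.castAdd k (Fin.natAdd m j)) =
          Fin.append (Fin.append a' b') c' (Fin.natAdd (m + k) j.rev)) ∧
        ∀ i, (∀ j : Fin k, i ≠ Fin.castAdd k (Fin.natAdd m j) ∧ i ≠ Fin.natAdd (m + k) j.rev) →
          Fin.append (Fin.append a b) c i = Fin.append (Fin.append a' b') c' i) ↔
      c = b ∘ Fin.rev ∧ c' = b' ∘ Fin.rev ∧ a = a' := by
    have hrev : ∀ b c : Fin k → Fin d, (∀ j, b j = c j.rev) ↔ c = b ∘ Fin.rev := fun b c =>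
      ⟨fun h => funext fun j => by simp [h], fun h j => by simp [h]⟩
    simp only [Fin.append_left, Fin.append_right, hrev]
    refine and_congr_right fun _ => and_congr_right fun _ => ⟨fun h => funext fun i => ?_, ?_⟩
    · have := h (Fin.castAdd k (Fin.castAdd k i)) fun j => ⟨fun h => ?_, fun h => ?_⟩
      · simpa using this
      · have := congrArg Fin.val h
        simp at this
        omega
      · have := congrArg Fin.val h
        simp at this
        omega
    · rintro rfl i hi
      revert hi
      refine Fin.addCases (fun i => Fin.addCases (fun i => ?_) (fun j => ?_) i)
        (fun j => ?_) i
      · intro hi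
        exact absurd (by rw [Fin.rev_rev]) (hi j.rev).2
      · simp
      · intro hi
        exact absurd rfl (hi j).1
  simp only [h]
  by_cases h1 : c = b ∘ Fin.rev <;> by_cases h2 : c' = b' ∘ Fin.rev <;>
    simp [h1, h2]

theorem trace_mul_Vk {d m k : ℕ} (A : Op d (m + k)) :
    (extendOp k A * Vk d m k).trace = A.trace := by
  rw [Vk_eq_pairing_mul_transpose, ← Matrix.mul_assoc, Matrix.trace_mul_comm, ← Matrix.mul_assoc,
    transpose_pairing_mul_mul_pairing, trace_partialTrace]

theorem trace_Vk_mul_Vk_mul {d m k : ℕ} (A B : Op d (m + k)) :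
    (Vk d m k * (extendOp k A * Vk d m k * extendOp k B)).trace =
      (partialTrace d m k A * partialTrace d m k B).trace := by
  rw [← transpose_pairing_mul_mul_pairing, ← transpose_pairing_mul_mul_pairing,
    Vk_eq_pairing_mul_transpose]
  simp only [Matrix.mul_assoc]
  rw [Matrix.trace_mul_comm]
  simp only [Matrix.mul_assoc]

end

end PartialTransposeAlgebra

namespace PartialTransposeAlgebra

open Matrix

noncomputable section

/-! ### Paths -/

theorem YPath.card_le {α : YoungDiagram} : ∀ {μ : YoungDiagram}, YPath α μ → α.card ≤ μ.card
  | _, .nil => le_rfl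
  | _, .cons r _ hcard => by have := r.card_le; omega

theorem YPath.append_right_injective {α β : YoungDiagram} : ∀ {μ : YoungDiagram} (r : YPath α μ),
    Function.Injective fun l : YPath β α => r.append l
  | _, .nil => fun _ _ h => h
  | _, .cons r _ _ => fun l l' h => by
    simp only [YPath.append, YPath.cons.injEq, heq_eq_eq, true_and] at h
    exact r.append_right_injective h

/-- Counting boxes excludes the mixed cases. This makes the indices (s, e) and (r, e) distinct for s
≠ r, so that off-diagonal traces vanish. -/
theorem YPath.append_left_injective {α β : YoungDiagram} (l : YPath β α) :
    ∀ {μ : YoungDiagram} (r s : YPath α μ), r.append l = s.append l → r = s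
  | _, .nil, .nil => fun _ => rfl
  | _, .nil, .cons s _ hcard => fun _ => by have := s.card_le; omega
  | _, .cons r _ hcard, .nil => fun _ => by have := r.card_le; omega
  | _, .cons r _ _, .cons s _ _ => fun h => by
    simp only [YPath.append, YPath.cons.injEq] at h
    obtain ⟨rfl, h⟩ := h
    rw [append_left_injective l r s (eq_of_heq h)]

/-- Every path passes through a diagram of each intermediate size. -/
theorem YPath.exists_append {m : ℕ} : ∀ {μ : YoungDiagram} (l : Idx μ), m ≤ μ.card →
    ∃ (β : Diagram m) (s : YPath β.1 μ) (p : Idx β.1), l = idx s p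
  | _, .nil => fun h => by
    have h0 : (⊥ : YoungDiagram).card = m := by
      simp only [YoungDiagram.card, YoungDiagram.cells_bot, Finset.card_empty] at h ⊢
      omega
    exact ⟨⟨⊥, h0⟩, .nil, .nil, rfl⟩
  | μ, .cons r hle hcard => fun h => by
    rcases h.eq_or_lt with h | h
    · exact ⟨⟨μ, h.symm⟩, .nil, .cons r hle hcard, rfl⟩
    · obtain ⟨β, s, p, rfl⟩ := r.exists_append (by omega : m ≤ _)
      exact ⟨β, .cons s hle hcard, p, rfl⟩

theorem pathDelta_eq_ite {α μ : YoungDiagram} (r s : YPath α μ) [Decidable (r = s)] :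
    pathDelta r s = if r = s then 1 else 0 := by
  unfold pathDelta
  by_cases h : r = s <;> simp [h]

theorem pathDelta_eq_zero_of_bot_ne {α β μ ν : YoungDiagram} (r : YPath α μ) (s : YPath β ν)
    (h : α ≠ β) : pathDelta r s = 0 := by
  unfold pathDelta
  rw [if_neg]
  intro h'
  simp only [Sigma.mk.injEq, Prod.mk.injEq] at h'
  exact h h'.1.1

theorem pathDelta_eq_zero_of_top_ne {α β μ ν : YoungDiagram} (r : YPath α μ) (s : YPath β ν)
    (h : μ ≠ ν) : pathDelta r s = 0 := by
  unfold pathDelta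
  rw [if_neg]
  intro h'
  simp only [Sigma.mk.injEq, Prod.mk.injEq] at h'
  exact h h'.1.2

theorem exists_eq_of_pathDelta_ne_zero {m : ℕ} {α β : Diagram m} {μ : YoungDiagram}
    {r : YPath α.1 μ} {s : YPath β.1 μ} (h : pathDelta s r ≠ 0) (p : Idx β.1) :
    ∃ q : Idx α.1, idx s p = idx r q := by
  by_cases hαβ : β = α
  · subst hαβ
    classical
    rw [pathDelta_eq_ite] at h
    have hrs : s = r := by
      by_contra hrs
      simp [hrs] at h
    exact ⟨p, by rw [hrs]⟩
  · exact absurd (pathDelta_eq_zero_of_bot_ne s r fun h => hαβ (Subtype.ext h)) h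

/-! ### The matrix units of the irreps in PRIR form -/

/-- The matrix units `E^μ_{ij}` as operators on the first `N` systems only. -/
def unitE (φ : RepFamily) (d : ℕ) {N : ℕ} (μ : Diagram N) (i j : Idx μ.1) : Op d N :=
  matUnit (φ.mat μ) (permOp d N) i j

theorem unitE_mem_permSpan (φ : RepFamily) (d : ℕ) {N : ℕ} (μ : Diagram N) (i j : Idx μ.1) :
    unitE φ d μ i j ∈ permSpan d N :=
  Submodule.smul_mem _ _ (Submodule.sum_mem _ fun g _ =>
    Submodule.smul_mem _ _ (Submodule.subset_span ⟨g, rfl⟩))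

theorem opE_eq_extendOp (φ : RepFamily) (d : ℕ) {N k : ℕ} (h : N ≤ N + k) (μ : Diagram N)
    (i j : Idx μ.1) : opE φ d h μ i j = extendOp k (unitE φ d μ i j) := by
  change _ = extendOpₗ d N k (unitE φ d μ i j)
  simp only [opE, unitE, matUnit, map_smul, map_sum, Fintype.card_perm, Fintype.card_fin,
    permOp_extendPerm]
  rfl

variable {φ : RepFamily}

theorem IsPRIR.not_equiv (hφ : IsPRIR φ) {N : ℕ} {μ ν : Diagram N} (h : μ ≠ ν) :
    ¬ Nonempty ((matRep (φ.mat μ)).Equiv (matRep (φ.mat ν))) :=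
  fun h' => h (hφ.inequivalent N μ ν h')

theorem IsPRIR.trace_unitE (hφ : IsPRIR φ) (d : ℕ) {N : ℕ} (μ : Diagram N) (i j : Idx μ.1) :
    (unitE φ d μ i j).trace = if i = j then (mult φ d μ : ℂ) else 0 :=
  trace_matUnit (φ.mat μ) (hφ.irreducible N μ) (permOp d N) i j

theorem IsPRIR.unitE_mul_unitE (hφ : IsPRIR φ) (d : ℕ) {N : ℕ} (μ : Diagram N)
    (i j k l : Idx μ.1) :
    unitE φ d μ i j * unitE φ d μ k l = if j = k then unitE φ d μ i l else 0 :=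
  matUnit_mul_matUnit (φ.mat μ) (hφ.irreducible N μ) (permOp d N) i j k l

theorem IsPRIR.unitE_mul_unitE_of_ne (hφ : IsPRIR φ) (d : ℕ) {N : ℕ} {μ ν : Diagram N}
    (h : μ ≠ ν) (i j : Idx μ.1) (k l : Idx ν.1) : unitE φ d μ i j * unitE φ d ν k l = 0 :=
  matUnit_mul_matUnit_eq_zero (φ.mat μ) (hφ.irreducible N μ) (φ.mat ν) (hφ.irreducible N ν)
    (hφ.not_equiv h) (permOp d N) i j k l

/-- Every index passes through some diagram with m boxes, so it lies in the block of s or in a block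
where f vanishes. It isolates one PRIR block in sums over all indices. -/
theorem sum_eq_sum_idx {m : ℕ} {β : Diagram m} {μ : YoungDiagram} (hm : m ≤ μ.card)
    (s : YPath β.1 μ) {R : Type*} [AddCommMonoid R] (f : Idx μ → R)
    (hf : ∀ (γ : Diagram m) (t : YPath γ.1 μ) (q : Idx γ.1), pathDelta t s = 0 → f (idx t q) = 0) :
    ∑ x, f x = ∑ p, f (idx s p) := by
  refine (Finset.sum_of_injOn (fun p => idx s p) (s.append_right_injective).injOn (by simp)
    (fun x _ hx => ?_) fun p _ => rfl).symm
  obtain ⟨γ, t, q, rfl⟩ := x.exists_append hm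
  refine hf γ t q ?_
  by_contra h
  obtain ⟨p, hp⟩ := exists_eq_of_pathDelta_ne_zero h q
  exact hx ⟨p, Finset.mem_coe.2 (Finset.mem_univ p), hp.symm⟩

theorem pathDelta_comm {α β μ ν : YoungDiagram} (r : YPath α μ) (s : YPath β ν) :
    pathDelta r s = pathDelta s r := by
  unfold pathDelta
  split_ifs with h1 h2 h2
  · rfl
  · exact absurd h1.symm h2
  · exact absurd h2.symm h1
  · rfl

theorem IsPRIR.permOp_mul_unitE (hφ : IsPRIR φ) (d : ℕ) {m k : ℕ} {β : Diagram m}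
    {μ : Diagram (m + k)} (s : YPath β.1 μ.1) (p : Idx β.1) (x : Idx μ.1)
    (κ : Equiv.Perm (Fin m)) :
    extendOp k (permOp d m κ) * unitE φ d μ (idx s p) x =
      ∑ p', φ.mat β κ p' p • unitE φ d μ (idx s p') x := by
  have hm : m ≤ μ.1.card := by rw [μ.2]; exact Nat.le_add_right m k
  rw [← permOp_extendPerm (Nat.le_add_right m k), unitE, rep_mul_matUnit, sum_eq_sum_idx hm s]
  · simp only [hφ.restrict_same, unitE]
  · intro γ t q h
    rw [hφ.restrict_ne m (m + k) _ μ γ β t s h, zero_smul]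

theorem IsPRIR.unitE_mul_permOp (hφ : IsPRIR φ) (d : ℕ) {m k : ℕ} {β : Diagram m}
    {μ : Diagram (m + k)} (s : YPath β.1 μ.1) (p : Idx β.1) (x : Idx μ.1)
    (κ : Equiv.Perm (Fin m)) :
    unitE φ d μ x (idx s p) * extendOp k (permOp d m κ) =
      ∑ p', φ.mat β κ p p' • unitE φ d μ x (idx s p') := by
  have hm : m ≤ μ.1.card := by rw [μ.2]; exact Nat.le_add_right m k
  rw [← permOp_extendPerm (Nat.le_add_right m k), unitE, matUnit_mul_rep, sum_eq_sum_idx hm s]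
  · simp only [hφ.restrict_same, unitE]
  · intro γ t q h
    rw [pathDelta_comm] at h
    rw [hφ.restrict_ne m (m + k) _ μ β γ s t h, zero_smul]

/-- Left multiplication by V_κ, κ ∈ S(m), passes through the partial trace and acts on the block s
as φ^β, so for fixed x these partial traces transform like the columns of φ^β. -/
theorem IsPRIR.unitE_mul_partialTrace (hφ : IsPRIR φ) (d : ℕ) {m k : ℕ} {β : Diagram m}
    {μ : Diagram (m + k)} (s : YPath β.1 μ.1) (p p' p'' : Idx β.1) (x : Idx μ.1) :
    unitE φ d β p' p'' * partialTrace d m k (unitE φ d μ (idx s p) x) =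
      if p'' = p then partialTrace d m k (unitE φ d μ (idx s p') x) else 0 :=
  map_matUnit_of_columns (φ.mat β) (hφ.irreducible m β) (permOp d m)
    (fun p => partialTrace d m k (unitE φ d μ (idx s p) x)) p (LinearMap.mulRight ℂ _)
    (fun g => by
      rw [LinearMap.mulRight_apply, ← partialTrace_extendOp_mul, hφ.permOp_mul_unitE]
      simp only [map_sum, map_smul]) p' p''

theorem IsPRIR.partialTrace_mul_unitE (hφ : IsPRIR φ) (d : ℕ) {m k : ℕ} {β : Diagram m}
    {μ : Diagram (m + k)} (s : YPath β.1 μ.1) (p p' p'' : Idx β.1) (x : Idx μ.1) :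
    partialTrace d m k (unitE φ d μ x (idx s p)) * unitE φ d β p' p'' =
      if p' = p then partialTrace d m k (unitE φ d μ x (idx s p'')) else 0 :=
  map_matUnit_of_rows (φ.mat β) (hφ.irreducible m β) (permOp d m)
    (fun p => partialTrace d m k (unitE φ d μ x (idx s p))) p (LinearMap.mulLeft ℂ _)
    (fun g => by
      rw [LinearMap.mulLeft_apply, ← partialTrace_mul_extendOp, hφ.unitE_mul_permOp]
      simp only [map_sum, map_smul]) p' p''

/-- For X = V_κ the scalar is the matrix element φ^α_{p'q}(κ); the rest is linearity. -/
theorem IsPRIR.unitE_mul_mul_unitE (hφ : IsPRIR φ) {d m : ℕ} (α : Diagram m) (p p' q q' : Idx α.1)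
    {X : Op d m} (hX : X ∈ permSpan d m) :
    ∃ c : ℂ, unitE φ d α p p' * X * unitE φ d α q q' = c • unitE φ d α p q' := by
  induction hX using Submodule.span_induction with
  | mem X hX =>
    obtain ⟨κ, rfl⟩ := hX
    refine ⟨φ.mat α κ p' q, ?_⟩
    rw [unitE, matUnit_mul_rep, Finset.sum_mul]
    change ∑ x, _ • unitE φ d α p x * unitE φ d α q q' = _
    simp [hφ.unitE_mul_unitE]
  | zero => exact ⟨0, by simp⟩
  | add X Y _ _ hX hY =>
    obtain ⟨a, ha⟩ := hX
    obtain ⟨b, hb⟩ := hY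
    exact ⟨a + b, by rw [mul_add, add_mul, ha, hb, add_smul]⟩
  | smul a X _ hX =>
    obtain ⟨b, hb⟩ := hX
    exact ⟨a * b, by rw [mul_smul_comm, smul_mul_assoc, hb, smul_smul]⟩

theorem IsPRIR.unitE_mul_mul_unitE_of_ne (hφ : IsPRIR φ) {d m : ℕ} {α β : Diagram m} (h : β ≠ α)
    (p p' : Idx β.1) (q q' : Idx α.1) {X : Op d m} (hX : X ∈ permSpan d m) :
    unitE φ d β p p' * X * unitE φ d α q q' = 0 := by
  induction hX using Submodule.span_induction with
  | mem X hX =>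
    obtain ⟨κ, rfl⟩ := hX
    rw [unitE, matUnit_mul_rep, Finset.sum_mul]
    change ∑ x, _ • unitE φ d β p x * unitE φ d α q q' = _
    simp [hφ.unitE_mul_unitE_of_ne d h]
  | zero => simp
  | add X Y _ _ hX hY => rw [mul_add, add_mul, hX, hY, add_zero]
  | smul a X _ hX => rw [mul_smul_comm, smul_mul_assoc, hX, smul_zero]

/-- Partial traces of matrix units, with blocks of the same type. -/
theorem IsPRIR.exists_partialTrace_unitE (hφ : IsPRIR φ) (d : ℕ) {m k : ℕ} {α : Diagram m}
    {μ : Diagram (m + k)} (s r : YPath α.1 μ.1) (e : Idx α.1) :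
    ∃ c : ℂ, c * mult φ d α = pathDelta s r * mult φ d μ ∧
      ∀ p q : Idx α.1, partialTrace d m k (unitE φ d μ (idx s p) (idx r q)) =
        c • unitE φ d α p q := by
  have hmem : partialTrace d m k (unitE φ d μ (idx s e) (idx r e)) ∈ permSpan d m :=
    partialTrace_mem_permSpan k (unitE_mem_permSpan φ d μ _ _)
  obtain ⟨c, hc⟩ := hφ.unitE_mul_mul_unitE α e e e e hmem
  -- Sandwiching between copies of E^α_{ee} leaves this partial trace unchanged, so it is itself a
  -- multiple of E^α_{ee}.
  rw [hφ.unitE_mul_partialTrace, if_pos rfl, hφ.partialTrace_mul_unitE, if_pos rfl] at hc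
  have h : ∀ p q : Idx α.1, partialTrace d m k (unitE φ d μ (idx s p) (idx r q)) =
      c • unitE φ d α p q := by
    intro p q
    have h1 : unitE φ d α p e * partialTrace d m k (unitE φ d μ (idx s e) (idx r e)) *
        unitE φ d α e q = partialTrace d m k (unitE φ d μ (idx s p) (idx r q)) := by
      rw [hφ.unitE_mul_partialTrace, if_pos rfl, hφ.partialTrace_mul_unitE, if_pos rfl]
    rw [← h1, hc, mul_smul_comm, smul_mul_assoc, hφ.unitE_mul_unitE, if_pos rfl,
      hφ.unitE_mul_unitE, if_pos rfl]
  refine ⟨c, ?_, h⟩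
  -- The partial trace preserves the trace, which fixes c m_α; nothing is divided, since m_α may be
  -- zero.
  have ht := congrArg Matrix.trace (h e e)
  rw [trace_partialTrace, hφ.trace_unitE, Matrix.trace_smul, hφ.trace_unitE, if_pos rfl,
    smul_eq_mul] at ht
  classical
  rw [← ht, pathDelta_eq_ite]
  by_cases hsr : s = r
  · simp [hsr]
  · rw [if_neg hsr, if_neg fun h => hsr (YPath.append_left_injective e s r h), zero_mul]

/-- Partial traces of matrix units, with blocks of different types. -/
theorem IsPRIR.partialTrace_unitE_of_ne (hφ : IsPRIR φ) (d : ℕ) {m k : ℕ} {α β : Diagram m}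
    (h : β ≠ α) {μ : Diagram (m + k)} (s : YPath β.1 μ.1) (r : YPath α.1 μ.1) (p : Idx β.1)
    (q : Idx α.1) : partialTrace d m k (unitE φ d μ (idx s p) (idx r q)) = 0 := by
  have h1 := hφ.unitE_mul_mul_unitE_of_ne h p p q q
    (partialTrace_mem_permSpan k (unitE_mem_permSpan φ d μ (idx s p) (idx r q)))
  rwa [hφ.unitE_mul_partialTrace, if_pos rfl, hφ.partialTrace_mul_unitE, if_pos rfl] at h1

theorem IsPRIR.mult_eq_zero (hφ : IsPRIR φ) {d m k : ℕ} {α : Diagram m} {μ : Diagram (m + k)}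
    (r : YPath α.1 μ.1) (e : Idx α.1) (hα : mult φ d α = 0) : mult φ d μ = 0 := by
  classical
  obtain ⟨c, hc, -⟩ := hφ.exists_partialTrace_unitE d r r e
  rw [pathDelta_eq_ite, if_pos rfl, one_mul, hα, Nat.cast_zero, mul_zero] at hc
  exact_mod_cast hc.symm

/-! ### Matrix elements -/

theorem matrixElement_eq (φ : RepFamily) (d : ℕ) {m k : ℕ} {α : Diagram m} {μ ν : Diagram (m + k)}
    (e : Idx α.1) (X : Op d (m + k + k)) (r : YPath α.1 μ.1) (r' : YPath α.1 ν.1)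
    (i : Idx μ.1) (j : Idx ν.1) :
    matrixElement φ d e X r r' i j =
      1 / (mult φ d α : ℂ) * (((mult φ d α : ℝ) / √((mult φ d μ : ℝ) * (mult φ d ν : ℝ)) : ℝ) : ℂ) *
        (X * (extendOp k (unitE φ d μ i (idx r e)) * Vk d m k *
          extendOp k (unitE φ d ν (idx r' e) j))).trace := by
  rw [matrixElement, opF, mul_smul_comm, Matrix.trace_smul, opE_eq_extendOp, opE_eq_extendOp,
    smul_eq_mul]
  exact (mul_assoc _ _ _).symm

theorem IsPRIR.matrixElement_Vk (hφ : IsPRIR φ) (d : ℕ) {m k : ℕ} {α β γ : Diagram m}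
    {μ ν : Diagram (m + k)} (e : Idx α.1) (r : YPath α.1 μ.1) (r' : YPath α.1 ν.1)
    (s : YPath β.1 μ.1) (s' : YPath γ.1 ν.1) (p : Idx β.1) (q : Idx γ.1) :
    matrixElement φ d e (Vk d m k) r r' (idx s p) (idx s' q) =
      pathDelta p q * pathDelta r s * pathDelta r' s' *
        ((√((mult φ d μ : ℝ) * (mult φ d ν : ℝ)) / (mult φ d α : ℝ) : ℝ) : ℂ) := by
  rw [matrixElement_eq, trace_Vk_mul_Vk_mul]
  by_cases hβ : β = α
  swap
  · rw [hφ.partialTrace_unitE_of_ne d hβ, zero_mul, Matrix.trace_zero, mul_zero,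
      pathDelta_eq_zero_of_bot_ne r s fun h => hβ (Subtype.ext h.symm)]
    ring
  by_cases hγ : γ = α
  swap
  · rw [hφ.partialTrace_unitE_of_ne d (Ne.symm hγ), mul_zero, Matrix.trace_zero, mul_zero,
      pathDelta_eq_zero_of_bot_ne r' s' fun h => hγ (Subtype.ext h.symm)]
    ring
  subst hβ hγ
  obtain ⟨a, ha, hA⟩ := hφ.exists_partialTrace_unitE d s r e
  obtain ⟨b, hb, hB⟩ := hφ.exists_partialTrace_unitE d r' s' e
  rw [hA, hB, smul_mul_assoc, mul_smul_comm, hφ.unitE_mul_unitE, if_pos rfl, Matrix.trace_smul,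
    Matrix.trace_smul, hφ.trace_unitE, smul_eq_mul, smul_eq_mul, pathDelta_comm r s]
  -- After the substitutions γ plays the role of α. If its multiplicity is zero, division by zero
  -- makes both sides vanish.
  by_cases hα : mult φ d γ = 0
  · simp [hα]
  have hα' : (mult φ d γ : ℂ) ≠ 0 := Nat.cast_ne_zero.2 hα
  obtain rfl := (eq_div_iff hα').2 ha
  obtain rfl := (eq_div_iff hα').2 hb
  rw [pathDelta_eq_ite p q]
  by_cases hpq : p = q
  swap
  · simp [hpq]
  rw [if_pos hpq, if_pos hpq]
  have hsq : (√((mult φ d μ : ℝ) * (mult φ d ν : ℝ)) : ℂ) ^ 2 = mult φ d μ * mult φ d ν := by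
    rw [← Complex.ofReal_pow, Real.sq_sqrt (by positivity)]
    push_cast
    ring
  set w : ℂ := (√((mult φ d μ : ℝ) * (mult φ d ν : ℝ)) : ℂ) with hw
  push_cast
  rw [← hw]
  -- Here m_μ m_ν = 0, and the normalization m_α / w of F is read as zero.
  by_cases hw0 : w = 0
  · simp [hw0]
  field_simp
  linear_combination (-pathDelta s r * pathDelta r' s') * hsq

theorem IsPRIR.matrixElement_permOp (hφ : IsPRIR φ) (d : ℕ) {m k : ℕ} {α : Diagram m}
    {μ ν : Diagram (m + k)} (e : Idx α.1) (r : YPath α.1 μ.1) (r' : YPath α.1 ν.1)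
    (τ : Equiv.Perm (Fin (m + k))) (i : Idx μ.1) (j : Idx ν.1) :
    matrixElement φ d e (permOp d (m + k + k) (extendPerm (Nat.le_add_right _ _) τ)) r r' i j =
      pathDelta r r' * ((√((mult φ d μ : ℝ) / (mult φ d ν : ℝ)) : ℝ) : ℂ) *
        ∑ l : Idx μ.1, pathDelta l j * φ.mat μ τ l i := by
  -- All factors besides V^(k) act on the first m + k systems; cyclicity gathers them on one side of
  -- V^(k), which then drops out of the trace.
  have htr : (extendOp k (permOp d (m + k) τ) * (extendOp k (unitE φ d μ i (idx r e)) *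
      Vk d m k * extendOp k (unitE φ d ν (idx r' e) j))).trace =
      (unitE φ d ν (idx r' e) j * (permOp d (m + k) τ * unitE φ d μ i (idx r e))).trace := by
    have h := trace_mul_Vk (k := k) (unitE φ d ν (idx r' e) j *
      (permOp d (m + k) τ * unitE φ d μ i (idx r e)))
    rw [← h, extendOp_mul, extendOp_mul, ← mul_assoc, Matrix.trace_mul_comm]
    simp only [mul_assoc]
  rw [matrixElement_eq, permOp_extendPerm, htr]
  have hmul : permOp d (m + k) τ * unitE φ d μ i (idx r e) =
      ∑ l, φ.mat μ τ l i • unitE φ d μ l (idx r e) := rep_mul_matUnit _ _ _ _ _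
  rw [hmul, Finset.mul_sum]
  by_cases hμν : μ = ν
  swap
  · simp only [mul_smul_comm, hφ.unitE_mul_unitE_of_ne d (Ne.symm hμν),
      pathDelta_eq_zero_of_top_ne r r' fun h => hμν (Subtype.ext h)]
    simp
  subst hμν
  classical
  simp only [mul_smul_comm, hφ.unitE_mul_unitE, smul_ite, smul_zero, Finset.sum_ite_eq,
    Finset.mem_univ, if_true, Matrix.trace_smul, hφ.trace_unitE, pathDelta_eq_ite, ite_mul,
    one_mul, zero_mul, Finset.sum_ite_eq', smul_eq_mul]
  by_cases hr : r = r'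
  swap
  · rw [if_neg hr, if_neg fun h => hr (YPath.append_left_injective e r r' h.symm)]
    ring
  subst hr
  rw [if_pos rfl, if_pos rfl]
  by_cases hμ : mult φ d μ = 0
  · simp [hμ]
  -- Cancelling m_α against 1 / m_α needs it nonzero; this follows from m_μ ≠ 0 because α lies on a
  -- path below μ.
  have hα : (mult φ d α : ℂ) ≠ 0 :=
    Nat.cast_ne_zero.2 fun h => hμ (hφ.mult_eq_zero r e h)
  have hμ' : (mult φ d μ : ℝ) ≠ 0 := Nat.cast_ne_zero.2 hμ
  have hμ'' : (mult φ d μ : ℂ) ≠ 0 := Nat.cast_ne_zero.2 hμ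
  rw [Real.sqrt_mul_self (Nat.cast_nonneg _), div_self hμ', Real.sqrt_one]
  push_cast
  field_simp

end

end PartialTransposeAlgebra

theorem mainTheorem9 (φ : RepFamily)
    (hφ : IsPRIR φ) (d m k : ℕ)
    (α : Diagram m) (e : Idx α.1)
    (μ ν : Diagram (m + k))
    (r : YPath α.1 μ.1) (r' : YPath α.1 ν.1) :
    (∀ (β γ : Diagram m)
        (s : YPath β.1 μ.1) (s' : YPath γ.1 ν.1)
        (p : Idx β.1) (q : Idx γ.1),
      matrixElement φ d e (Vk d m k) r r'
          (idx s p) (idx s' q) =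
        pathDelta p q * pathDelta r s *
          pathDelta r' s' *
          ((√((mult φ d μ : ℝ) * (mult φ d ν : ℝ)) /
            (mult φ d α : ℝ) : ℝ) : ℂ)) ∧
    (∀ (τ : Equiv.Perm (Fin (m + k))) (i : Idx μ.1)
        (j : Idx ν.1),
      matrixElement φ d e
          (permOp d (m + k + k)
            (extendPerm (Nat.le_add_right _ _) τ)) r r' i j =
        pathDelta r r' *
          ((√((mult φ d μ : ℝ) /
            (mult φ d ν : ℝ)) : ℝ) : ℂ) *
          ∑ l : Idx μ.1,
            pathDelta l j * φ.mat μ τ l i) :=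
  ⟨fun _ _ s s' p q => hφ.matrixElement_Vk d e r r' s s' p q,
    fun τ i j => hφ.matrixElement_permOp d e r r' τ i j⟩
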